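/- **Definitions.** Let $\mathbb F$ be a field; all Lie algebras and associative algebras are over $\mathbb F$ and may be infinite dimensional. A Lie algebra $L$ is *zero product determined* (zpd) if for every bilinear map $f:L\times L\to\mathbb F$ such that $[x,y]=0$ implies $f(x,y)=0$ for all $x,y\in L$, there is a linear map $\Phi:[L,L]\to\mathbb F$ with $f(x,y)=\Phi([x,y])$ for all $x,y\in L$. A linear map $\varphi:L\to L'$ of Lie algebras *preserves commutativity* if $[x,y]=0$ implies $[\varphi(x),\varphi(y)]=0$ for all $x,y\in L$. Let $Q$ be a unital associative ring with center $C$, let $R\subseteq Q$, and let $d\ge 1$. For $x=(x_1,\dots,x_m)\in R^m$, write $x^{i}\in R^{m-1}$ and $x^{ij}\in R^{m-2}$ for the tuples obtained by omitting $x_i$, respectively $x_i$ and $x_j$ ($i\neq j$). The set $R$ is a *$d$-free subset* of $Q$ if for all $m\ge 1$, all $I,J\subseteq\{1,\dots,m\}$ and all functions $E_i,F_j:R^{m-1}\to Q$ ($i\in I$, $j\in J$) the following two conditions hold: (a) if $\max\{|I|,|J|\}\le d$ and $\sum_{i\in I}E_i(x^i)x_i+\sum_{j\in J}x_jF_j(x^j)=0$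 for all $x\in R^m$, then $(*)$ holds; (b) if $\max\{|I|,|J|\}\le d-1$ and $\sum_{i\in I}E_i(x^i)x_i+\sum_{j\in J}x_jF_j(x^j)\in C$ for all $x\in R^m$, then $(*)$ holds. Here $(*)$ says that there exist functions $p_{ij}:R^{m-2}\to Q$ ($i\in I$, $j\in J$, $i\ne j$) and $\lambda_k:R^{m-1}\to C$ ($k\in I\cup J$), with $\lambda_k=0$ if $k\notin I\cap J$, such that for all $x\in R^m$ $$E_i(x^i)=\sum_{j\in J,\,j\neq i}x_jp_{ij}(x^{ij})+\lambda_i(x^i)\quad(i\in I),\qquad F_j(x^j)=-\sum_{i\in I,\,i\neq j}p_{ij}(x^{ij})x_i-\lambda_j(x^j)\quad(j\in J).$$ **Theorem.** Let $\mathbb F$ be a field with $\operatorname{char}\mathbb F\ne 2$, and let $L$ and $L'$ be Lie algebras over $\mathbb F$. Suppose that $L$ is zpd, that $L'$ has zero center, and that $L'$ is a Lie subalgebra (with respect to $[a,b]=ab-ba$) of a unital associative $\mathbb F$-algebra $A$ whose center equals $\mathbb F1$. If $L'$ is a $3$-free subset of $A$, then for every bijective linear map $\varphi:L\to L'$ that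 preserves commutativity there exist a nonzero scalar $c\in\mathbb F$ and a Lie algebra isomorphism $\theta:L\to L'$ such that $\varphi(x)=c\,\theta(x)$ for all $x\in L$. -/

import Mathlib

/-- A Lie algebra `L` over a field `F` is zero product determined if every bilinear form
`f : L × L → F` which vanishes on all pairs of commuting elements is of the form
`f (x, y) = Φ [x, y]` for some linear functional `Φ` on the derived algebra `[L, L]`. -/
def IsZeroProductDetermined (F L : Type*) [Field F] [LieRing L] [LieAlgebra F L] : Prop :=
  ∀ f : L →ₗ[F] L →ₗ[F] F, (∀ x y : L, ⁅x, y⁆ = 0 → f x y = 0) →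
    ∃ Φ : ↥(⁅(⊤ : LieIdeal F L), (⊤ : LieIdeal F L)⁆ : LieIdeal F L) →ₗ[F] F,
      ∀ x y : L, f x y =
        Φ ⟨⁅x, y⁆, LieSubmodule.lie_mem_lie (LieSubmodule.mem_top x) (LieSubmodule.mem_top y)⟩

namespace FunctionalIdentity

variable {Q : Type*} [Ring Q] {R : Set Q} {m : ℕ}

/-- The tuple obtained from `x = (x₁, …, xₘ)` by omitting the entry with index `i`. -/
def omit₁ (x : Fin m → R) (i : Fin m) : {k : Fin m // k ≠ i} → R :=
  fun k => x k

/-- The tuple obtained from `x = (x₁, …, xₘ)` by omitting the entries with indices `i` and `j`. -/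
def omit₂ (x : Fin m → R) (i j : Fin m) : {k : Fin m // k ≠ i ∧ k ≠ j} → R :=
  fun k => x k

/-- The expression `∑_{i ∈ I} Eᵢ(x without xᵢ) xᵢ + ∑_{j ∈ J} xⱼ Fⱼ(x without xⱼ)`.
The maps `Eᵢ` and `Fⱼ` are arbitrary functions of `m - 1` variables from `R`. -/
def expression (I J : Finset (Fin m)) (E F : (i : Fin m) → ({k : Fin m // k ≠ i} → R) → Q)
    (x : Fin m → R) : Q :=
  ∑ i ∈ I, E i (omit₁ x i) * (x i : Q) + ∑ j ∈ J, (x j : Q) * F j (omit₁ x j)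

/-- `E`, `F` is a standard solution: there are functions `pᵢⱼ` of `m - 2` variables from `R` with
values in `Q`, and functions `lₖ` of `m - 1` variables from `R` with values in the center of `Q`,
vanishing for `k ∉ I ∩ J`, such that for all `x` in `R ^ m`
`Eᵢ(x without xᵢ) = ∑_{j ∈ J, j ≠ i} xⱼ pᵢⱼ(x without xᵢ, xⱼ) + lᵢ(x without xᵢ)` for `i ∈ I`,
`Fⱼ(x without xⱼ) = - ∑_{i ∈ I, i ≠ j} pᵢⱼ(x without xᵢ, xⱼ) xᵢ - lⱼ(x without xⱼ)` for `j ∈ J`. -/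
def IsStandardSolution (I J : Finset (Fin m))
    (E F : (i : Fin m) → ({k : Fin m // k ≠ i} → R) → Q) : Prop :=
  ∃ (p : (i j : Fin m) → ({k : Fin m // k ≠ i ∧ k ≠ j} → R) → Q)
    (l : (k : Fin m) → ({n : Fin m // n ≠ k} → R) → Q),
    (∀ k y, l k y ∈ Subring.center Q) ∧
    (∀ k, k ∉ I ∩ J → ∀ y, l k y = 0) ∧
    (∀ i ∈ I, ∀ x : Fin m → R,
      E i (omit₁ x i) = ∑ j ∈ J.erase i, (x j : Q) * p i j (omit₂ x i j) + l i (omit₁ x i)) ∧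
    (∀ j ∈ J, ∀ x : Fin m → R,
      F j (omit₁ x j) = -∑ i ∈ I.erase j, p i j (omit₂ x i j) * (x i : Q) - l j (omit₁ x j))

end FunctionalIdentity

/-- A subset `R` of a unital ring `Q` is `d`-free (`d ≥ 1`) if for all `m` and all
`I, J ⊆ {1, …, m}`:
* if `max (|I|, |J|) ≤ d`, then every solution of the functional identity `expression = 0` on
  `R ^ m` is standard;
* if `max (|I|, |J|) ≤ d - 1`, then every solution of the functional identity
  `expression ∈ center of Q` on `R ^ m` is standard. -/
def IsFreeSubset (d : ℕ) {Q : Type*} [Ring Q] (R : Set Q) : Prop :=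
  ∀ (m : ℕ) (I J : Finset (Fin m)) (E F : (i : Fin m) → ({k : Fin m // k ≠ i} → R) → Q),
    (max I.card J.card ≤ d →
      (∀ x : Fin m → R, FunctionalIdentity.expression I J E F x = 0) →
      FunctionalIdentity.IsStandardSolution I J E F) ∧
    (max I.card J.card < d →
      (∀ x : Fin m → R, FunctionalIdentity.expression I J E F x ∈ Subring.center Q) →
      FunctionalIdentity.IsStandardSolution I J E F)

/-- A map `φ` between Lie algebras preserves commutativity if `φ x` and `φ y` commute whenever
`x` and `y` commute. -/
def PreservesCommutativity {L M : Type*} [LieRing L] [LieRing M] (φ : L → M) : Prop :=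
  ∀ x y : L, ⁅x, y⁆ = 0 → ⁅φ x, φ y⁆ = 0

/- An associative algebra is regarded as a Lie algebra with bracket `⁅a, b⁆ = a * b - b * a`. -/
attribute [local instance 100] LieRing.ofAssociativeRing

/-! Put B(u, v) = φ[φ⁻¹u, φ⁻¹v] on L'. For each functional ω, the form ω[φx, φy] kills commuting
pairs, so zpd factors it through [x, y]; Jacobi in L then gives [B(u, v), w] + cyclic = 0
(`cyclic_sum_eq_zero`). By 3-freeness B is quasi-polynomial
(`exists_of_cyclic_sum_commutator_eq_zero`), and anticommutativity reduces it to c[u, v] modulo the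
center (`exists_eq_mul_commutator_add`). As L' has zero center, φ[x, y] = c[φx, φy], so cφ is a
homomorphism; if c = 0, both algebras are abelian. -/

namespace IsFreeSubset

open FunctionalIdentity

variable {Q : Type*} [Ring Q] {R : Set Q} {d : ℕ}

/-! ### One-sided identities -/

/-- In a one-sided identity with coefficients on the left, all coefficients vanish. -/
theorem left_coeff_eq_zero (h : IsFreeSubset d R) {m : ℕ} (hm : m < d)
    (E : (i : Fin m) → ({k : Fin m // k ≠ i} → R) → Q)
    (hE : ∀ x : Fin m → R, ∑ i, E i (omit₁ x i) * (x i : Q) ∈ Subring.center Q)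
    (i : Fin m) (x : Fin m → R) : E i (omit₁ x i) = 0 := by
  obtain ⟨p, l, -, hl, h₁, -⟩ := (h m Finset.univ ∅ E 0).2 (by simpa using hm)
    (fun x => by simpa [expression] using hE x)
  simpa [hl i (by simp)] using h₁ i (Finset.mem_univ i) x

/-- In a one-sided identity with value `0`, all coefficients on the left vanish. -/
theorem left_coeff_eq_zero_of_sum_eq_zero (h : IsFreeSubset d R) {m : ℕ} (hm : m ≤ d)
    (E : (i : Fin m) → ({k : Fin m // k ≠ i} → R) → Q)
    (hE : ∀ x : Fin m → R, ∑ i, E i (omit₁ x i) * (x i : Q) = 0)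
    (i : Fin m) (x : Fin m → R) : E i (omit₁ x i) = 0 := by
  obtain ⟨p, l, -, hl, h₁, -⟩ := (h m Finset.univ ∅ E 0).1 (by simpa using hm)
    (fun x => by simpa [expression] using hE x)
  simpa [hl i (by simp)] using h₁ i (Finset.mem_univ i) x

/-- In a one-sided identity with coefficients on the right, all coefficients vanish. -/
theorem right_coeff_eq_zero (h : IsFreeSubset d R) {m : ℕ} (hm : m < d)
    (G : (i : Fin m) → ({k : Fin m // k ≠ i} → R) → Q)
    (hG : ∀ x : Fin m → R, ∑ i, (x i : Q) * G i (omit₁ x i) ∈ Subring.center Q)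
    (i : Fin m) (x : Fin m → R) : G i (omit₁ x i) = 0 := by
  obtain ⟨p, l, -, hl, -, h₂⟩ := (h m ∅ Finset.univ 0 G).2 (by simpa using hm)
    (fun x => by simpa [expression] using hG x)
  simpa [hl i (by simp)] using h₂ i (Finset.mem_univ i) x

theorem eq_zero_of_mul_mem_center (h : IsFreeSubset d R) (hd : 1 < d) [Nonempty R] {a : Q}
    (ha : ∀ x : R, (x : Q) * a ∈ Subring.center Q) : a = 0 :=
  h.right_coeff_eq_zero hd (fun _ _ => a) (fun x => by simpa using ha (x 0)) 0
    fun _ => Classical.arbitrary R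

/-- In one variable a standard solution has no `p` terms; only the central term remains. -/
theorem mem_center_of_commutator_mem_center (h : IsFreeSubset d R) (hd : 1 < d) [Nonempty R]
    {a : Q} (ha : ∀ x : R, a * x - x * a ∈ Subring.center Q) : a ∈ Subring.center Q := by
  obtain ⟨p, l, hc, -, h₁, -⟩ := (h 1 Finset.univ Finset.univ (fun _ _ => a) (fun _ _ => -a)).2
    (by simpa using hd) (fun x => by simpa [expression, sub_eq_add_neg] using ha (x 0))
  have : a = _ := h₁ 0 (Finset.mem_univ 0) fun _ => Classical.arbitrary R
  rw [this]
  simpa using hc 0 _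

theorem eq_zero_of_mul_add_mul_mem_center (h : IsFreeSubset d R) (hd : 2 < d)
    {e : R → Q} (he : ∀ x y : R, e x * y + e y * x ∈ Subring.center Q) (x : R) : e x = 0 := by
  -- Addition in `Fin 2` wraps around, so `i + 1` is the other variable.
  refine h.left_coeff_eq_zero hd (fun i y => e (y ⟨i + 1, by decide +revert⟩)) (fun y => ?_) 0
    fun _ => x
  simpa [Fin.sum_univ_two, omit₁] using he (y 1) (y 0)

theorem eq_zero_of_mul_sub_mul_eq_zero (h : IsFreeSubset d R) (hd : 2 < d)
    {g : R → Q} (hg : ∀ x y : R, (x : Q) * g y - y * g x = 0) (x : R) : g x = 0 := by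
  refine h.right_coeff_eq_zero hd
    (fun i y => if i = 0 then g (y ⟨i + 1, by decide +revert⟩)
      else -g (y ⟨i + 1, by decide +revert⟩)) (fun y => ?_) 0 fun _ => x
  have := hg (y 0) (y 1)
  simp only [Fin.sum_univ_two, omit₁]
  simp [← sub_eq_add_neg, this]

theorem eq_zero_of_cyclic_sum_mul_eq_zero (h : IsFreeSubset d R) (hd : 3 ≤ d) {e : R → R → Q}
    (he : ∀ x y z : R, e x y * z + e y z * x + e z x * y = 0) (x y : R) : e x y = 0 := by
  refine h.left_coeff_eq_zero_of_sum_eq_zero hd (fun i t =>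
    e (t ⟨i + 1, by decide +revert⟩) (t ⟨i + 2, by decide +revert⟩)) (fun t => ?_) 2 ![x, y, x]
  have := he (t 0) (t 1) (t 2)
  simp only [Fin.sum_univ_three, omit₁]
  rw [← this]
  change e (t 1) (t 2) * _ + e (t 2) (t 0) * _ + e (t 0) (t 1) * _ = _
  abel

/-! ### Two-sided identities -/

/-- The solutions of `e₁(y) x + e₂(x) y + x g₁(y) + y g₂(x) = 0`. -/
theorem exists_right_coeff_of_two_variables (h : IsFreeSubset d R) (hd : 2 ≤ d)
    {e₁ e₂ g₁ g₂ : R → Q}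
    (hh : ∀ x y : R, e₁ y * x + e₂ x * y + x * g₁ y + y * g₂ x = 0) :
    ∃ (a b : Q) (α β : R → Q), (∀ x, α x ∈ Subring.center Q) ∧ (∀ x, β x ∈ Subring.center Q) ∧
      (∀ x : R, g₁ x = a * x + α x) ∧ ∀ x : R, g₂ x = b * x + β x := by
  obtain ⟨p, l, hc, -, -, h₂⟩ := (h 2 Finset.univ Finset.univ
    (fun i t => ![e₁, e₂] i (t ⟨i + 1, by decide +revert⟩))
    (fun i t => ![g₁, g₂] i (t ⟨i + 1, by decide +revert⟩))).1 (by simpa using hd)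
    (fun t => by
      have := hh (t 0) (t 1)
      simp only [expression, Fin.sum_univ_two, omit₁]
      rw [← this, add_assoc (_ + _)]
      rfl)
  -- Omitting both variables leaves the empty tuple, so each `p i j` is a constant.
  have hp : ∀ i j : Fin 2, i ≠ j → ∀ t t' : Fin 2 → R,
      p i j (omit₂ t i j) = p i j (omit₂ t' i j) := fun i j hij t t' => by
    congr 1
    funext ⟨k, hk⟩
    omega
  by_cases hR : Nonempty R
  swap
  · exact ⟨0, 0, 0, 0, fun _ => zero_mem _, fun _ => zero_mem _,
      fun x => (hR ⟨x⟩).elim, fun x => (hR ⟨x⟩).elim⟩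
  let t₀ : Fin 2 → R := fun _ => Classical.arbitrary R
  refine ⟨-p 1 0 (omit₂ t₀ 1 0), -p 0 1 (omit₂ t₀ 0 1), fun x => -l 0 (fun _ => x),
    fun x => -l 1 (fun _ => x), fun x => neg_mem (hc _ _), fun x => neg_mem (hc _ _),
    fun x => ?_, fun x => ?_⟩
  · have := h₂ 0 (Finset.mem_univ _) fun _ => x
    rw [show (Finset.univ : Finset (Fin 2)).erase 0 = {1} by decide, Finset.sum_singleton,
      hp 1 0 (by decide) _ t₀, sub_eq_add_neg, ← neg_mul] at this
    exact this
  · have := h₂ 1 (Finset.mem_univ _) fun _ => x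
    rw [show (Finset.univ : Finset (Fin 2)).erase 1 = {0} by decide, Finset.sum_singleton,
      hp 0 1 (by decide) _ t₀, sub_eq_add_neg, ← neg_mul] at this
    exact this

/-- The form of the maps (not assumed biadditive) whose cyclic sum of commutators vanishes. -/
theorem exists_of_cyclic_sum_commutator_eq_zero (h : IsFreeSubset d R) (hd : 3 ≤ d)
    {B : R → R → Q}
    (hB : ∀ x y z : R, (B x y * z - z * B x y) + (B y z * x - x * B y z) +
      (B z x * y - y * B z x) = 0) :
    ∃ (a b : Q) (α β : R → Q) (l : R → R → Q), (∀ x, α x ∈ Subring.center Q) ∧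
      (∀ x, β x ∈ Subring.center Q) ∧ (∀ x y, l x y ∈ Subring.center Q) ∧
      ∀ x y : R, B x y = x * (a * y + α y) + y * (b * x + β x) + l x y := by
  obtain ⟨p, l, hc, -, h₁, h₂⟩ := (h 3 Finset.univ Finset.univ
    (fun i t => B (t ⟨i + 1, by decide +revert⟩) (t ⟨i + 2, by decide +revert⟩))
    (fun i t => -B (t ⟨i + 1, by decide +revert⟩) (t ⟨i + 2, by decide +revert⟩))).1
    (by simpa using hd)
    (fun t => by
      have := hB (t 0) (t 1) (t 2)
      simp only [expression, Fin.sum_univ_three, omit₁]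
      rw [← this]
      change B (t 1) (t 2) * _ + B (t 2) (t 0) * _ + B (t 0) (t 1) * _ +
        (_ * -B (t 1) (t 2) + _ * -B (t 2) (t 0) + _ * -B (t 0) (t 1)) = _
      noncomm_ring)
  have hp : ∀ (i j k : Fin 3), i ≠ j → k ≠ i → k ≠ j → ∀ t : Fin 3 → R,
      omit₂ t i j = fun _ => t k := fun i j k hij hi hj t => by
    funext ⟨n, hn⟩
    have : n = k := by omega
    exact congrArg t this
  -- `B x y` is the coefficient at index 2; the last entry of `![x, y, x]` is a dummy.
  have hE : ∀ x y : R, B x y = x * p 2 0 (fun _ => y) + y * p 2 1 (fun _ => x) +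
      l 2 (omit₁ ![x, y, x] 2) := fun x y => by
    have := h₁ 2 (Finset.mem_univ _) ![x, y, x]
    rw [show (Finset.univ : Finset (Fin 3)).erase 2 = {0, 1} by decide,
      Finset.sum_pair (by decide), hp 2 0 1 (by decide) (by decide) (by decide),
      hp 2 1 0 (by decide) (by decide) (by decide)] at this
    exact this
  have hG : ∀ x y : R, -B x y = -(p 0 2 (fun _ => y) * x + p 1 2 (fun _ => x) * y) -
      l 2 (omit₁ ![x, y, x] 2) := fun x y => by
    have := h₂ 2 (Finset.mem_univ _) ![x, y, x]
    rw [show (Finset.univ : Finset (Fin 3)).erase 2 = {0, 1} by decide,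
      Finset.sum_pair (by decide), hp 0 2 1 (by decide) (by decide) (by decide),
      hp 1 2 0 (by decide) (by decide) (by decide)] at this
    exact this
  -- Adding the two expressions for ±B cancels `l` and leaves an identity in two variables.
  obtain ⟨a, b, α, β, hα, hβ, ha, hb⟩ := h.exists_right_coeff_of_two_variables
    (by omega : 2 ≤ d) (e₁ := fun y => -p 0 2 (fun _ => y)) (e₂ := fun x => -p 1 2 (fun _ => x))
    (g₁ := fun y => p 2 0 (fun _ => y)) (g₂ := fun x => p 2 1 (fun _ => x)) (fun x y => by
      have h' := congrArg₂ (· + ·) (hE x y) (hG x y)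
      simp only [add_neg_cancel] at h'
      rw [h']
      noncomm_ring)
  exact ⟨a, b, α, β, fun x y => l 2 (omit₁ ![x, y, x] 2), hα, hβ, fun _ _ => hc _ _,
    fun x y => by rw [hE, ha, hb]⟩

/-- An anticommutative map whose cyclic sum of commutators vanishes is a central multiple of the
commutator modulo the center. -/
theorem exists_eq_mul_commutator_add (h : IsFreeSubset d R) (hd : 3 ≤ d) [Nonempty R]
    (h2 : ∀ q : Q, q + q = 0 → q = 0) {B : R → R → Q} (hanti : ∀ x y, B x y = -B y x)
    (hB : ∀ x y z : R, (B x y * z - z * B x y) + (B y z * x - x * B y z) +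
      (B z x * y - y * B z x) = 0) :
    ∃ a ∈ Subring.center Q, ∀ x y : R, B x y - a * (x * y - y * x) ∈ Subring.center Q := by
  obtain ⟨a, b, α, β, l, hα, hβ, hl, hBf⟩ := h.exists_of_cyclic_sum_commutator_eq_zero hd hB
  have hαc : ∀ x q, α x * q = q * α x := fun x q => (Subring.mem_center_iff.1 (hα x) q).symm
  have hβc : ∀ x q, β x * q = q * β x := fun x q => (Subring.mem_center_iff.1 (hβ x) q).symm
  have hlc : ∀ x y q, l x y * q = q * l x y :=
    fun x y q => (Subring.mem_center_iff.1 (hl x y) q).symm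
  have hsum : ∀ x : R, x * (a + b) + (α x + β x) = 0 :=
    h.eq_zero_of_mul_add_mul_mem_center (by omega) fun x y => by
      have h' := hanti x y
      rw [hBf, hBf] at h'
      have : (x * (a + b) + (α x + β x)) * y + (y * (a + b) + (α y + β y)) * x =
          -(l x y + l y x) := by
        rw [← sub_eq_zero] at h' ⊢
        rw [← h']
        simp only [mul_add, add_mul, mul_assoc, hαc, hβc]
        abel
      rw [this]
      exact neg_mem (add_mem (hl _ _) (hl _ _))
  have hab : a + b = 0 := h.eq_zero_of_mul_mem_center (by omega) fun x => by
    rw [eq_neg_of_add_eq_zero_left (hsum x)]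
    exact neg_mem (add_mem (hα x) (hβ x))
  obtain rfl : b = -a := eq_neg_of_add_eq_zero_right hab
  have hαβ : ∀ x, α x = -β x := fun x => by
    have := hsum x
    rw [hab, mul_zero, zero_add] at this
    exact eq_neg_of_add_eq_zero_left this
  have hBf' : ∀ x y : R, B x y = x * a * y - y * a * x + (y * β x - x * β y) + l x y :=
    fun x y => by
      rw [hBf, hαβ]
      noncomm_ring
  -- This is the coefficient of z once the cyclic identity is sorted by rightmost factor.
  have hcyc : ∀ x y : R, (x : Q) * (a * y - y * a - (β y + β y)) -
      y * (a * x - x * a - (β x + β x)) = 0 :=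
    h.eq_zero_of_cyclic_sum_mul_eq_zero hd fun x y z => by
      have h' := hB x y z
      have hcomm : ∀ x y z : R, B x y * z - z * B x y =
          (x * a * y - y * a * x) * z - z * (x * a * y - y * a * x) +
            (β x * (y * z - z * y) - β y * (x * z - z * x)) := fun x y z => by
        rw [hBf', add_mul _ (l x y), mul_add _ _ (l x y), hlc, hβc, hβc]
        have h₁ := hβc x z
        have h₂ := hβc y z
        rw [add_mul, sub_mul (_ * β x), mul_assoc _ (β x), mul_assoc _ (β y), h₁, h₂]
        noncomm_ring
      rw [hcomm, hcomm, hcomm] at h'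
      rw [← h']
      simp only [hβc, mul_sub, sub_mul, mul_add, add_mul, mul_assoc]
      abel
  have hcomm : ∀ x : R, a * x - x * a - (β x + β x) = 0 :=
    h.eq_zero_of_mul_sub_mul_eq_zero (by omega) hcyc
  have ha : a ∈ Subring.center Q :=
    -- [a, x] = 2β(x) is central for all x in R.
    h.mem_center_of_commutator_mem_center (by omega) fun x => by
      rw [sub_eq_zero.1 (hcomm x)]
      exact add_mem (hβ x) (hβ x)
  have hac : ∀ q, q * a = a * q := Subring.mem_center_iff.1 ha
  have hβ0 : ∀ x, β x = 0 := fun x => h2 _ (by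
    have := hcomm x
    rwa [hac, sub_self, zero_sub, neg_eq_zero] at this)
  refine ⟨a, ha, fun x y => ?_⟩
  rw [hBf', hβ0, hβ0, hac, hac]
  convert hl x y using 1
  noncomm_ring

end IsFreeSubset

/-! ### Lie algebras -/

/-- The Jacobi identity in a zero product determined Lie algebra is carried over by linear maps
preserving commutativity. -/
theorem IsZeroProductDetermined.cyclic_sum_eq_zero {F L M : Type*} [Field F] [LieRing L]
    [LieAlgebra F L] [LieRing M] [LieAlgebra F M] (hL : IsZeroProductDetermined F L)
    (φ : L →ₗ[F] M) (hφ : PreservesCommutativity φ) (x y z : L) :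
    ⁅φ ⁅x, y⁆, φ z⁆ + ⁅φ ⁅y, z⁆, φ x⁆ + ⁅φ ⁅z, x⁆, φ y⁆ = 0 := by
  -- zpd concerns scalar forms; functionals separate the points of `M`.
  rw [← Module.forall_dual_apply_eq_zero_iff F]
  intro ω
  obtain ⟨Φ, hΦ⟩ := hL
    (((LieModule.toEnd F M M : M →ₗ[F] Module.End F M).compl₁₂ φ φ).compr₂ ω)
    (fun x y hxy => by simp [hφ x y hxy])
  have hΦ' : ∀ x y : L, ω ⁅φ x, φ y⁆ = _ := hΦ
  rw [map_add, map_add, hΦ', hΦ', hΦ', ← map_add, ← map_add]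
  convert map_zero Φ
  apply Subtype.ext
  change ⁅⁅x, y⁆, z⁆ + ⁅⁅y, z⁆, x⁆ + ⁅⁅z, x⁆, y⁆ = 0
  rw [← lie_skew ⁅x, y⁆ z, ← lie_skew ⁅y, z⁆ x, ← lie_skew ⁅z, x⁆ y, ← neg_add, ← neg_add, neg_eq_zero,
    ← lie_jacobi x y z]
  abel

theorem theorem9p3 {F L A : Type*} [Field F] (hF : ringChar F ≠ 2)
    [LieRing L] [LieAlgebra F L] (hL : IsZeroProductDetermined F L)
    [Ring A] [Algebra F A] (hA : Subalgebra.center F A = ⊥)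
    (L' : LieSubalgebra F A) (hcenter : LieAlgebra.center F L' = ⊥)
    (hfree : IsFreeSubset 3 (L' : Set A))
    (φ : L →ₗ[F] L') (hbij : Function.Bijective φ) (hφ : PreservesCommutativity φ) :
    ∃ c : F, c ≠ 0 ∧ ∃ θ : L ≃ₗ⁅F⁆ L', ∀ x : L, φ x = c • θ x := by
  let e : L ≃ₗ[F] L' := LinearEquiv.ofBijective φ hbij
  have he : ∀ x, φ (e.symm x) = x := e.apply_symm_apply
  have hscalar : ∀ a ∈ Subring.center A, ∃ c : F, algebraMap F A c = a := fun a ha => by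
    have : a ∈ Subalgebra.center F A := ha
    rwa [hA, Algebra.mem_bot] at this
  have h2 : ∀ q : A, q + q = 0 → q = 0 := fun q hq => by
    rw [← two_smul F] at hq
    exact (smul_eq_zero_iff_right (Ring.two_ne_zero hF)).1 hq
  have : Nonempty (L' : Set A) := ⟨⟨0, L'.zero_mem⟩⟩
  obtain ⟨a, ha, hB⟩ := hfree.exists_eq_mul_commutator_add le_rfl h2
    (B := fun x y => (φ ⁅e.symm x, e.symm y⁆ : A))
    (fun x y => by rw [← lie_skew, map_neg]; rfl)
    (fun x y z => by
      have := congrArg (Subtype.val) (hL.cyclic_sum_eq_zero φ hφ (e.symm x) (e.symm y) (e.symm z))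
      rwa [he, he, he] at this)
  obtain ⟨c, rfl⟩ := hscalar a ha
  have hmain : ∀ x y : L, φ ⁅x, y⁆ = c • ⁅φ x, φ y⁆ := fun x y => by
    rw [← sub_eq_zero, ← LieSubmodule.mem_bot (R := F) (L := L'), ← hcenter,
      LieModule.mem_maxTrivSubmodule]
    intro z
    have := Subring.mem_center_iff.1 (hB (φ x) (φ y)) z
    have hx : ∀ x, e.symm (φ x) = x := e.symm_apply_apply
    rw [hx, hx, ← Algebra.smul_def, ← sub_eq_zero] at this
    exact Subtype.ext this
  by_cases hc : c = 0
  -- Here φ[x, y] = 0, so injectivity makes L abelian and φ itself serves as θ.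
  · refine ⟨1, one_ne_zero, { e with map_lie' := fun {x y} => ?_ }, fun x => (one_smul _ _).symm⟩
    have hxy : φ ⁅x, y⁆ = 0 := by rw [hmain, hc, zero_smul]
    have hxy' : ⁅x, y⁆ = 0 := hbij.1 (by rw [hxy, map_zero])
    exact hxy.trans (hφ x y hxy').symm
  · refine ⟨c⁻¹, inv_ne_zero hc, { e.trans (LinearEquiv.smulOfNeZero F L' c hc) with
      map_lie' := fun {x y} => ?_ }, fun x => (inv_smul_smul₀ hc _).symm⟩
    change c • φ ⁅x, y⁆ = ⁅c • φ x, c • φ y⁆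
    rw [hmain, smul_lie, lie_smul]
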